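/- A directed graph has an asymmetric (hence irreflexive) edge relation; write $x\perp y$ if there is no edge between $x$ and $y$ in either direction. For $n\in\mathbb N$, a complete $n$-partite directed graph is a directed graph for which $\perp$ is an equivalence relation with at most $n$ classes (its parts). Let $n*I_\omega$ be the Fraïssé limit of the class of all finite complete $n$-partite directed graphs. Let $n*I_\omega^*$ be an expansion of $n*I_\omega$ by $n$ unary relations $P_0,\dots,P_{n-1}$, which enumerate the parts of $n*I_\omega$ without repetition, and by a linear order $<$ for which every part is convex and such that $P_0<\dots<P_{n-1}$ (that is, $x<y$ whenever $x\in P_i$, $y\in P_j$ and $i<j$). For structures $\mathbf A,\mathbf C$ in one relational language let $\binom{\mathbf C}{\mathbf A}$ be the set of substructures of $\mathbf C$ isomorphic to $\mathbf A$, and write $\mathbf C\to(\mathbf B)^{\mathbf A}_k$ if for every map $c:\binom{\mathbf C}{\mathbf A}\to\{0,\dots,k-1\}$ there is $\mathbf B'\in\binom{\mathbf C}{\mathbf B}$ such that $c$ takes at most one value on $\binom{\mathbf B'}{\mathbf A}$. **Theorem.** For every $n\in\mathbb N$ the age of $n*I_\omega^*$, i.e. the class $\mathcal K$ of all finite structures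 that embed into $n*I_\omega^*$, has the Ramsey property: for all $k\in\mathbb N$ and all $\mathbf A,\mathbf B\in\mathcal K$ there is $\mathbf C\in\mathcal K$ with $\mathbf C\to(\mathbf B)^{\mathbf A}_k$. -/

import Mathlib

namespace PartiteRamsey

open FirstOrder FirstOrder.Language FirstOrder.Language.Structure CategoryTheory

universe u v w w'

/-! ### Copies, the arrow relation and the Ramsey property -/

section Ramsey

variable {L : FirstOrder.Language.{u, v}}

/-- The copies of `A` in `C`: the substructures of `C` that are isomorphic to `A`. -/
def Copies (L : FirstOrder.Language.{u, v}) (C : Type w) (A : Type w')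
    [L.Structure C] [L.Structure A] : Set (L.Substructure C) :=
  {S | Nonempty (S ≃[L] A)}

/-- The arrow relation `C → (B)^A_k`: for every colouring of the copies of `A` in `C` with `k`
colours there is a copy `B'` of `B` in `C` all of whose copies of `A` have the same colour. -/
def Arrows (L : FirstOrder.Language.{u, v}) (C B A : Type w)
    [L.Structure C] [L.Structure B] [L.Structure A] (k : ℕ) : Prop :=
  ∀ c : Copies L C A → Fin k, ∃ B' ∈ Copies L C B,
    ∀ A₁ A₂ : Copies L C A, A₁.1 ≤ B' → A₂.1 ≤ B' → c A₁ = c A₂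

/-- The Ramsey property of a class of structures. -/
def RamseyProperty (K : Set (Bundled.{w} L.Structure)) : Prop :=
  ∀ k : ℕ, ∀ A ∈ K, ∀ B ∈ K, ∃ C ∈ K, Arrows L C B A k

end Ramsey

/-! ### Complete `n`-partite directed graphs

Directed graphs are structures for Mathlib's language with one binary relation symbol `adj`. -/

section Digraph

variable {V : Type w} [FirstOrder.Language.graph.Structure V]

/-- There is a directed edge from `x` to `y`. -/
def Edge (x y : V) : Prop := RelMap FirstOrder.Language.adj ![x, y]

/-- The non-edge relation `x ⊥ y`: there is no edge between `x` and `y` in either direction. -/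
def NonEdge (x y : V) : Prop := ¬ Edge x y ∧ ¬ Edge y x

variable (V) in
/-- `V` is a complete `n`-partite directed graph: the edge relation is asymmetric (hence
irreflexive), and non-adjacency is an equivalence relation with at most `n` classes. -/
structure IsCompletePartite (n : ℕ) : Prop where
  asymm : ∀ x y : V, Edge x y → ¬ Edge y x
  equiv : Equivalence (NonEdge : V → V → Prop)
  card_le : ENat.card (Quotient (Setoid.mk NonEdge equiv)) ≤ n

/-- The class of all finite complete `n`-partite directed graphs. -/
def completePartiteClass (n : ℕ) : Set (Bundled.{w} FirstOrder.Language.graph.Structure) :=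
  {V | Finite V ∧ IsCompletePartite V n}

variable (V) in
/-- `V` is (a copy of) the generic complete `n`-partite directed graph `n * I_ω`: the Fraïssé limit
of the class of finite complete `n`-partite directed graphs. -/
abbrev IsGenericPartite [Countable V] (n : ℕ) : Prop :=
  IsFraisseLimit (completePartiteClass.{w} n) V

end Digraph

/-! ### The expansion by parts and a convex linear order -/

/-- The new relation symbols: unary `part i` for `i < n`, and binary `lt`. -/
inductive PartOrderRel (n : ℕ) : ℕ → Type
  | part (i : Fin n) : PartOrderRel n 1
  | lt : PartOrderRel n 2

/-- The language of the new relation symbols. -/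
def partOrder (n : ℕ) : FirstOrder.Language := ⟨fun _ => Empty, PartOrderRel n⟩

instance (n : ℕ) : IsRelational (partOrder n) := fun _ => inferInstanceAs (IsEmpty Empty)

/-- The language of the expansion: `adj`, the unary symbols `part i` for `i < n`, and `lt`. -/
abbrev expandedLanguage (n : ℕ) : FirstOrder.Language := FirstOrder.Language.graph.sum (partOrder n)

section Expansion

variable {n : ℕ} {V : Type w} [(partOrder n).Structure V]

/-- `x` satisfies the unary predicate `P_i`. -/
def Part (i : Fin n) (x : V) : Prop :=
  RelMap (L := partOrder n) (PartOrderRel.part i : (partOrder n).Relations 1) ![x]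

variable (n) in
/-- The interpretation of the symbol `lt`. -/
def Lt (x y : V) : Prop :=
  RelMap (L := partOrder n) (PartOrderRel.lt : (partOrder n).Relations 2) ![x, y]

variable (n V) in
/-- The new relations on the digraph `V` are: `n` unary predicates that enumerate the parts (the
classes of non-adjacency) without repetition, and a linear order for which the parts are convex and
come in the order `P_0 < ... < P_{n-1}`. -/
structure IsConvexPartExpansion [FirstOrder.Language.graph.Structure V] : Prop where
  part_eq_class : ∀ i : Fin n, ∃ x : V, ∀ y : V, Part i y ↔ NonEdge x y
  existsUnique_part : ∀ x : V, ∃! i : Fin n, Part i x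
  irrefl : ∀ x : V, ¬ Lt n x x
  trans : ∀ x y z : V, Lt n x y → Lt n y z → Lt n x z
  total : ∀ x y : V, Lt n x y ∨ x = y ∨ Lt n y x
  convex : ∀ x y z : V, NonEdge x z → Lt n x y → Lt n y z → NonEdge x y
  part_lt : ∀ i j : Fin n, i < j → ∀ x y : V, Part i x → Part j y → Lt n x y

end Expansion

/-! ### Existence of the generic complete `n`-partite digraph and of its expansion -/

section Existence

/-- The vertices of a concrete copy of the generic complete `n`-partite digraph: part and index. -/
abbrev GenericVertex (n : ℕ) : Type := Fin n × ℕ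

namespace GenericVertex

variable {n : ℕ}

/-- The adjacency of the concrete model: it is decided by binary digits. -/
def Adj (u v : GenericVertex n) : Prop :=
  u.1 ≠ v.1 ∧ ((u.2 < v.2 ∧ v.2.testBit (u.2 * n + u.1) = true) ∨
    (v.2 < u.2 ∧ u.2.testBit (v.2 * n + v.1) = false) ∨ (u.2 = v.2 ∧ u.1 < v.1))

local instance : FirstOrder.Language.graph.Structure (GenericVertex n) where
  RelMap | .adj => fun x => Adj (x 0) (x 1)

theorem edge_iff (u v : GenericVertex n) : Edge u v ↔ Adj u v := Iff.rfl

theorem nonEdge_iff (u v : GenericVertex n) : NonEdge u v ↔ u.1 = v.1 := by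
  unfold NonEdge
  rw [edge_iff, edge_iff]
  unfold Adj
  constructor
  · rintro ⟨h1, h2⟩
    by_contra h
    have h' : v.1 ≠ u.1 := fun e => h e.symm
    rcases lt_trichotomy u.2 v.2 with h3 | h3 | h3
    · rcases hb : v.2.testBit (u.2 * n + u.1) with _ | _
      · exact h2 ⟨h', Or.inr (Or.inl ⟨h3, hb⟩)⟩
      · exact h1 ⟨h, Or.inl ⟨h3, hb⟩⟩
    · rcases lt_or_gt_of_ne h with h4 | h4
      · exact h1 ⟨h, Or.inr (Or.inr ⟨h3, h4⟩)⟩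
      · exact h2 ⟨h', Or.inr (Or.inr ⟨h3.symm, h4⟩)⟩
    · rcases hb : u.2.testBit (v.2 * n + v.1) with _ | _
      · exact h1 ⟨h, Or.inr (Or.inl ⟨h3, hb⟩)⟩
      · exact h2 ⟨h', Or.inl ⟨h3, hb⟩⟩
  · intro h
    exact ⟨fun h1 => h1.1 h, fun h1 => h1.1 h.symm⟩

theorem edge_asymm (u v : GenericVertex n) (h : Edge u v) : ¬ Edge v u := by
  rw [edge_iff] at h ⊢
  rintro ⟨_, h2⟩
  obtain ⟨_, h1⟩ := h
  rcases h1 with ⟨a, b⟩ | ⟨a, b⟩ | ⟨a, b⟩ <;> rcases h2 with ⟨c, d⟩ | ⟨c, d⟩ | ⟨c, d⟩ <;>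
    first | omega | (rw [b] at d; exact absurd d (by decide))

theorem isCompletePartite : IsCompletePartite (GenericVertex n) n := by
  have hE : Equivalence (NonEdge : GenericVertex n → GenericVertex n → Prop) :=
    ⟨fun x => (nonEdge_iff x x).2 rfl,
      fun {x y} h => (nonEdge_iff y x).2 ((nonEdge_iff x y).1 h).symm,
      fun {x y z} h h' => (nonEdge_iff x z).2
        (((nonEdge_iff x y).1 h).trans ((nonEdge_iff y z).1 h'))⟩
  refine ⟨edge_asymm, hE, ?_⟩
  have hinj : Function.Injective (Quotient.lift (s := Setoid.mk NonEdge hE)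
      (fun x : GenericVertex n => x.1) fun x y h => (nonEdge_iff x y).1 h) := by
    intro a b
    induction a using Quotient.inductionOn
    induction b using Quotient.inductionOn
    intro h
    exact Quotient.sound ((nonEdge_iff _ _).2 h)
  simpa using ENat.card_le_card_of_injective hinj

/-- Every finite one-point extension problem is solvable. -/
theorem exists_extension (S : Finset (GenericVertex n)) (i : Fin n) (hS : ∀ s ∈ S, s.1 ≠ i)
    (P : GenericVertex n → Prop) (F : Finset (GenericVertex n)) :
    ∃ p : GenericVertex n, p.1 = i ∧ p ∉ F ∧
      (∀ s ∈ S, Edge s p ↔ P s) ∧ ∀ s ∈ S, Edge p s ↔ ¬ P s := by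
  classical
  obtain ⟨N, hN⟩ : ∃ N : ℕ, ∀ s ∈ S ∪ F, s.2 < N ∧ s.2 * n + s.1 < N := by
    refine ⟨(S ∪ F).sup (fun s => s.2 + (s.2 * n + s.1)) + 1, fun s hs => ?_⟩
    have := Finset.le_sup (f := fun s : GenericVertex n => s.2 + (s.2 * n + s.1)) hs
    omega
  let g : Fin (N + 1) → Bool := fun k => decide ((k : ℕ) = N ∨
    ∃ s ∈ S, P s ∧ s.2 * n + s.1 = (k : ℕ))
  let b := Nat.ofBits g
  have hb : N < b := by
    have : b.testBit N = true := by
      simp [b, g]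
    exact lt_of_lt_of_le Nat.lt_two_pow_self (Nat.ge_two_pow_of_testBit this)
  have hP : ∀ s ∈ S, (b.testBit (s.2 * n + s.1) = true ↔ P s) := by
    intro s hs
    have h1 := hN s (Finset.mem_union_left _ hs)
    rw [Nat.testBit_ofBits_lt g _ (by omega)]
    simp only [g, decide_eq_true_eq]
    constructor
    · rintro (h | ⟨t, _, ht, e⟩)
      · omega
      · have hn : 0 < n := i.pos
        have e2 : t.2 = s.2 := by
          have := congrArg (· / n) e
          simpa [Nat.add_div_of_dvd_right, Nat.mul_add_div, hn, mul_comm _ n,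
            Nat.div_eq_of_lt t.1.isLt, Nat.div_eq_of_lt s.1.isLt] using this
        have e1 : t.1 = s.1 := by
          rw [e2] at e
          exact Fin.ext (by omega)
        have : t = s := Prod.ext e1 e2
        exact this ▸ ht
    · intro h
      exact Or.inr ⟨s, hs, h, rfl⟩
  let p : GenericVertex n := (i, b)
  have key : ∀ s ∈ S, Edge s p ↔ P s := by
    intro s hs
    have h1 := hN s (Finset.mem_union_left _ hs)
    rw [edge_iff, ← hP s hs]
    unfold Adj
    have h2 : s.2 < p.2 := lt_trans h1.1 hb
    constructor
    · rintro ⟨_, h | h | h⟩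
      · exact h.2
      · omega
      · omega
    · intro h
      exact ⟨hS s hs, Or.inl ⟨h2, h⟩⟩
  refine ⟨p, rfl, ?_, key, ?_⟩
  · intro hF
    have := (hN p (Finset.mem_union_right _ hF)).1
    change b < N at this
    omega
  · intro s hs
    rw [← key s hs]
    constructor
    · exact edge_asymm _ _
    · intro h
      by_contra h'
      exact hS s hs ((nonEdge_iff s p).1 ⟨h, h'⟩)

/-- A partial embedding of a finite complete `n`-partite digraph extends to one more point. -/
theorem exists_extend_one {T : Type*} [FirstOrder.Language.graph.Structure T]
    (hT : IsCompletePartite T n) (s : Finset T) (h : T → GenericVertex n)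
    (hinj : ∀ x ∈ s, ∀ y ∈ s, h x = h y → x = y)
    (hE : ∀ x ∈ s, ∀ y ∈ s, Edge (h x) (h y) ↔ Edge x y) (t : T) :
    ∃ p : GenericVertex n, (∀ x ∈ s, h x ≠ p) ∧ (∀ x ∈ s, Edge (h x) p ↔ Edge x t) ∧
      ∀ x ∈ s, Edge p (h x) ↔ Edge t x := by
  classical
  have hN : ∀ x ∈ s, ∀ y ∈ s, NonEdge x y ↔ (h x).1 = (h y).1 := by
    intro x hx y hy
    rw [← nonEdge_iff]
    unfold NonEdge
    rw [hE x hx y hy, hE y hy x hx]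
  obtain ⟨i, hi⟩ : ∃ i : Fin n, ∀ x ∈ s, (h x).1 = i ↔ NonEdge x t := by
    by_cases hx : ∃ x ∈ s, NonEdge x t
    · obtain ⟨x, hx, hxt⟩ := hx
      refine ⟨(h x).1, fun y hy => ?_⟩
      rw [← hN y hy x hx]
      exact ⟨fun e => hT.equiv.trans e hxt, fun e => hT.equiv.trans e (hT.equiv.symm hxt)⟩
    · push Not at hx
      by_contra hcon
      push Not at hcon
      have : ∀ i : Fin n, ∃ x ∈ s, (h x).1 = i := by
        intro i
        obtain ⟨x, hxs, hh⟩ := hcon i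
        refine ⟨x, hxs, ?_⟩
        rcases hh with hh | hh
        · exact hh.1
        · exact absurd hh.2 (hx x hxs)
      choose c hcs hc using this
      let φ : Option (Fin n) → Quotient (Setoid.mk NonEdge hT.equiv) := fun o =>
        Quotient.mk _ (o.elim t c)
      have hφ : Function.Injective φ := by
        intro a b hab
        have hab' : NonEdge (a.elim t c) (b.elim t c) := Quotient.exact hab
        rcases a with _ | a <;> rcases b with _ | b
        · rfl
        · exact absurd (hT.equiv.symm hab') (hx _ (hcs b))
        · exact absurd hab' (hx _ (hcs a))
        · have := (hN _ (hcs a) _ (hcs b)).1 hab'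
          rw [hc, hc] at this
          rw [this]
      have h1 := (ENat.card_le_card_of_injective hφ).trans hT.card_le
      simp only [ENat.card_eq_coe_fintype_card, Fintype.card_option, Fintype.card_fin] at h1
      have h2 : n + 1 ≤ n := by exact_mod_cast h1
      omega
  obtain ⟨p, hp, hpF, h1, h2⟩ := exists_extension ((s.image h).filter fun u => u.1 ≠ i) i
    (fun u hu => (Finset.mem_filter.1 hu).2) (fun u => ∃ x ∈ s, h x = u ∧ Edge x t) (s.image h)
  have hdet : ∀ x ∈ s, ((∃ y ∈ s, h y = h x ∧ Edge y t) ↔ Edge x t) := fun x hx =>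
    ⟨fun ⟨y, hy, e, hyt⟩ => hinj y hy x hx e ▸ hyt, fun e => ⟨x, hx, rfl, e⟩⟩
  refine ⟨p, fun x hx e => hpF (e ▸ Finset.mem_image_of_mem h hx), fun x hx => ?_, fun x hx => ?_⟩
  · by_cases hxi : (h x).1 = i
    · have h3 := (hi x hx).1 hxi
      have h4 := (nonEdge_iff (h x) p).2 (hxi.trans hp.symm)
      exact ⟨fun e => absurd e h4.1, fun e => absurd e h3.1⟩
    · rw [h1 _ (Finset.mem_filter.2 ⟨Finset.mem_image_of_mem h hx, hxi⟩), hdet x hx]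
  · by_cases hxi : (h x).1 = i
    · have h3 := (hi x hx).1 hxi
      have h4 := (nonEdge_iff (h x) p).2 (hxi.trans hp.symm)
      exact ⟨fun e => absurd e h4.2, fun e => absurd e h3.2⟩
    · rw [h2 _ (Finset.mem_filter.2 ⟨Finset.mem_image_of_mem h hx, hxi⟩), hdet x hx]
      have h3 : ¬ NonEdge x t := fun e => hxi ((hi x hx).2 e)
      constructor
      · intro h4
        by_contra h5
        exact h3 ⟨h4, h5⟩
      · intro h4 h5
        exact hT.asymm _ _ h4 h5

/-- A partial embedding of a finite complete `n`-partite digraph extends to the whole digraph. -/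
theorem exists_extend {T : Type*} [FirstOrder.Language.graph.Structure T] [Finite T]
    (hT : IsCompletePartite T n) (s : Finset T) (h : T → GenericVertex n)
    (hinj : ∀ x ∈ s, ∀ y ∈ s, h x = h y → x = y)
    (hE : ∀ x ∈ s, ∀ y ∈ s, Edge (h x) (h y) ↔ Edge x y) :
    ∃ f : T ↪[FirstOrder.Language.graph] GenericVertex n, ∀ x ∈ s, f x = h x := by
  classical
  have := Fintype.ofFinite T
  suffices H : ∀ u : Finset T, ∃ k : T → GenericVertex n, (∀ x ∈ s, k x = h x) ∧
      (∀ x ∈ s ∪ u, ∀ y ∈ s ∪ u, k x = k y → x = y) ∧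
      ∀ x ∈ s ∪ u, ∀ y ∈ s ∪ u, Edge (k x) (k y) ↔ Edge x y by
    obtain ⟨k, hk, h1, h2⟩ := H Finset.univ
    refine ⟨⟨⟨k, fun x y e => h1 x (by simp) y (by simp) e⟩, fun f => f.elim, ?_⟩, hk⟩
    rintro m ⟨⟩ x
    have := h2 (x 0) (by simp) (x 1) (by simp)
    unfold Edge at this
    have e1 : (k ∘ x) = ![k (x 0), k (x 1)] := by
      funext j; fin_cases j <;> rfl
    have e2 : x = ![x 0, x 1] := by
      funext j; fin_cases j <;> rfl
    change RelMap _ (k ∘ x) ↔ RelMap _ x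
    rw [e1]
    conv_rhs => rw [e2]
    exact this
  intro u
  induction u using Finset.induction_on with
  | empty => exact ⟨h, fun _ _ => rfl, by simpa using hinj, by simpa using hE⟩
  | insert t u _ ih =>
    obtain ⟨k, hk, h1, h2⟩ := ih
    by_cases ht : t ∈ s ∪ u
    · have : s ∪ insert t u = s ∪ u := by
        rw [Finset.union_insert, Finset.insert_eq_self.2 ht]
      exact ⟨k, hk, this ▸ h1, this ▸ h2⟩
    · obtain ⟨p, hp, h3, h4⟩ := exists_extend_one hT (s ∪ u) k h1 h2 t
      have hne : ∀ x ∈ s ∪ u, x ≠ t := fun x hx e => ht (e ▸ hx)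
      refine ⟨Function.update k t p, fun x hx => ?_, ?_, ?_⟩
      · rw [Function.update_of_ne (hne x (Finset.mem_union_left _ hx)), hk x hx]
      · rw [Finset.union_insert]
        intro x hx y hy
        rcases Finset.mem_insert.1 hx with rfl | hx' <;>
          rcases Finset.mem_insert.1 hy with rfl | hy'
        · exact fun _ => rfl
        · rw [Function.update_self, Function.update_of_ne (hne y hy')]
          exact fun e => absurd e.symm (hp y hy')
        · rw [Function.update_self, Function.update_of_ne (hne x hx')]
          exact fun e => absurd e (hp x hx')
        · rw [Function.update_of_ne (hne x hx'), Function.update_of_ne (hne y hy')]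
          exact h1 x hx' y hy'
      · rw [Finset.union_insert]
        intro x hx y hy
        rcases Finset.mem_insert.1 hx with rfl | hx' <;>
          rcases Finset.mem_insert.1 hy with rfl | hy'
        · exact ⟨fun e => absurd e (edge_asymm _ _ e), fun e => absurd e (hT.asymm _ _ e)⟩
        · rw [Function.update_self, Function.update_of_ne (hne y hy')]
          exact h4 y hy'
        · rw [Function.update_self, Function.update_of_ne (hne x hx')]
          exact h3 x hx'
        · rw [Function.update_of_ne (hne x hx'), Function.update_of_ne (hne y hy')]
          exact h2 x hx' y hy'

theorem edge_embedding {T U : Type*} [FirstOrder.Language.graph.Structure T]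
    [FirstOrder.Language.graph.Structure U] (f : T ↪[FirstOrder.Language.graph] U) (x y : T) :
    Edge (f x) (f y) ↔ Edge x y := by
  unfold Edge
  rw [← f.map_rel]
  have e1 : (f ∘ ![x, y]) = ![f x, f y] := by
    funext j; fin_cases j <;> rfl
  rw [e1]

/-- The class of complete `n`-partite digraphs is closed under substructures. -/
theorem isCompletePartite_of_embedding {T U : Type*} [FirstOrder.Language.graph.Structure T]
    [FirstOrder.Language.graph.Structure U] (f : T ↪[FirstOrder.Language.graph] U)
    (hU : IsCompletePartite U n) : IsCompletePartite T n := by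
  have hN : ∀ x y, NonEdge (f x) (f y) ↔ NonEdge x y := fun x y => by
    unfold NonEdge; rw [edge_embedding, edge_embedding]
  have hE : Equivalence (NonEdge : T → T → Prop) :=
    ⟨fun x => (hN x x).1 (hU.equiv.refl _), fun h => (hN _ _).1 (hU.equiv.symm ((hN _ _).2 h)),
      fun h h' => (hN _ _).1 (hU.equiv.trans ((hN _ _).2 h) ((hN _ _).2 h'))⟩
  refine ⟨fun x y => ?_, hE, le_trans ?_ hU.card_le⟩
  · rw [← edge_embedding f, ← edge_embedding f]
    exact hU.asymm _ _
  · refine ENat.card_le_card_of_injective (f := Quotient.map (sa := Setoid.mk NonEdge hE)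
      (sb := Setoid.mk NonEdge hU.equiv) f fun x y h => (hN x y).2 h) ?_
    intro a b
    induction a using Quotient.inductionOn
    induction b using Quotient.inductionOn
    intro h
    exact Quotient.sound ((hN _ _).1 (Quotient.exact h))

theorem isGenericPartite : IsGenericPartite (GenericVertex n) n := by
  classical
  constructor
  · rw [isUltrahomogeneous_iff_IsExtensionPair Structure.cg_of_countable,
      isExtensionPair_iff_exists_embedding_closure_singleton_sup]
    intro S hS f m
    have hfin : (Substructure.closure FirstOrder.Language.graph {m} ⊔ S).FG :=
      (Substructure.fg_closure (Set.finite_singleton m)).sup hS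
    have : Finite ↥(Substructure.closure FirstOrder.Language.graph {m} ⊔ S) := hfin.finite
    have := Fintype.ofFinite ↥(Substructure.closure FirstOrder.Language.graph {m} ⊔ S)
    let k : ↥(Substructure.closure FirstOrder.Language.graph {m} ⊔ S) → GenericVertex n :=
      fun x => if hx : x.1 ∈ S then f ⟨x.1, hx⟩ else x.1
    have hk : ∀ x : S, k (Substructure.inclusion le_sup_right x) = f x := fun x => by
      have : (Substructure.inclusion
        (le_sup_right : S ≤ Substructure.closure FirstOrder.Language.graph {m} ⊔ S) x).1 ∈ S := x.2
      simp only [k, dif_pos this]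
      rfl
    obtain ⟨g, hg⟩ := exists_extend (n := n)
      (isCompletePartite_of_embedding (Substructure.subtype _) isCompletePartite)
      (Finset.univ.filter fun x => x.1 ∈ S) k (by
        intro x hx y hy e
        have hx := (Finset.mem_filter.1 hx).2
        have hy := (Finset.mem_filter.1 hy).2
        simp only [k, dif_pos hx, dif_pos hy] at e
        exact Subtype.ext (congrArg (fun z : S => z.1) (f.injective e))) (by
        intro x hx y hy
        have hx := (Finset.mem_filter.1 hx).2
        have hy := (Finset.mem_filter.1 hy).2
        simp only [k, dif_pos hx, dif_pos hy]
        rw [edge_embedding f, ← edge_embedding (Substructure.subtype S),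
          ← edge_embedding (Substructure.subtype _) x y]
        rfl)
    refine ⟨g, ?_⟩
    refine Embedding.ext fun x => ?_
    rw [Embedding.comp_apply, hg _ (Finset.mem_filter.2 ⟨Finset.mem_univ _, x.2⟩), hk]
  · ext T
    constructor
    · rintro ⟨h1, ⟨f⟩⟩
      exact ⟨Structure.fg_iff_finite.1 h1, isCompletePartite_of_embedding f isCompletePartite⟩
    · rintro ⟨h1, h2⟩
      have : Finite T := h1
      have hd : Nonempty (T → GenericVertex n) := by
        rcases isEmpty_or_nonempty T with h | ⟨⟨t⟩⟩
        · exact ⟨fun t => isEmptyElim t⟩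
        · rcases Nat.eq_zero_or_pos n with rfl | hn
          · have h3 := h2.card_le
            rw [Nat.cast_zero, nonpos_iff_eq_zero, ENat.card_eq_zero_iff_empty] at h3
            exact (h3.false (Quotient.mk _ t)).elim
          · exact ⟨fun _ => (⟨0, hn⟩, 0)⟩
      obtain ⟨f, -⟩ := exists_extend h2 ∅ hd.some (by simp) (by simp)
      exact ⟨Structure.fg_iff_finite.2 h1, ⟨f⟩⟩

local instance : (partOrder n).Structure (GenericVertex n) where
  RelMap
    | .part i => fun x => (x 0).1 = i
    | .lt => fun x => toLex (x 0) < toLex (x 1)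

theorem isConvexPartExpansion : IsConvexPartExpansion n (GenericVertex n) := by
  have hP : ∀ (i : Fin n) (x : GenericVertex n), Part i x ↔ x.1 = i := fun _ _ => Iff.rfl
  have hL : ∀ x y : GenericVertex n, Lt n x y ↔ toLex x < toLex y := fun _ _ => Iff.rfl
  refine ⟨fun i => ⟨(i, 0), fun y => ?_⟩, fun x => ⟨x.1, rfl, fun j h => h.symm⟩, fun x => ?_,
    fun x y z => ?_, fun x y => ?_, fun x y z => ?_, fun i j hij x y => ?_⟩
  · rw [hP, nonEdge_iff]; exact eq_comm
  · rw [hL]; exact lt_irrefl _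
  · simp only [hL]; exact lt_trans
  · simp only [hL]; exact lt_trichotomy (toLex x) (toLex y)
  · simp only [hL, nonEdge_iff, Prod.Lex.toLex_lt_toLex]
    intro h1 h2 h3
    omega
  · simp only [hL, hP, Prod.Lex.toLex_lt_toLex]
    rintro rfl rfl
    exact Or.inl hij

end GenericVertex

/-- `n * I_ω` exists, and it has an expansion by its parts and a convex linear order. -/
theorem exists_isGenericPartite (n : ℕ) :
    ∃ (V : Type) (_ : Countable V) (_ : FirstOrder.Language.graph.Structure V)
      (_ : (partOrder n).Structure V), IsGenericPartite V n ∧ IsConvexPartExpansion n V :=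
  ⟨GenericVertex n, inferInstance, _, _, GenericVertex.isGenericPartite,
    GenericVertex.isConvexPartExpansion⟩

end Existence

end PartiteRamsey

namespace PartiteRamsey

open FirstOrder FirstOrder.Language FirstOrder.Language.Structure CategoryTheory

universe u v w

/-! ### Ramsey's theorem -/

/-! A finite structure in the age, listed increasingly, becomes a linear order with a colouring of
ordered pairs: the colour of (x, y) records the part of x and, if y lies in a higher part, whether x
→ y. The core is a Ramsey theorem for finite linear orders with arbitrarily coloured pairs
(`exists_pattern_mono`), proved by the partite construction. Ramsey's theorem supplies N; a copy of
B is placed over every b-subset of `Fin N`. For each pattern and each increasing α in turn,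
Hales–Jewett (`exists_section_mono`) enlarges the system so that some copy of the old system has all
its sections of that pattern over α in one colour. In the end the colour depends only on pattern and
projection, and Ramsey's theorem picks a b-subset on which the projection no longer matters.

The coloured order so obtained has to be found inside M. Genericity gives the digraph with the right
labels (`IsGenericPartite.exists_realization`), but says nothing about the order of M inside a part.
The remedy (`exists_ordered_realization`) is to combine copies of the given digraph, one for each
choice of the parts to be reversed, and to apply the pattern theorem to pairs within a part,
coloured by whether M agrees with the order. Agreement becomes constant on each part, and the copy
with matching reversals is ordered by M as required.

Across parts the order is dictated by the labels. Hence an increasing sequence with the pattern of B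
spans a copy of B, and the copies of A inside it come from increasing sequences with the pattern of
A. -/

/-- The finite Ramsey theorem for colourings of the `a`-element sets of natural numbers. -/
theorem exists_homogeneous_finset (κ : Type*) [Finite κ] [Nonempty κ] (a b : ℕ) :
    ∃ N : ℕ, ∀ (c : Finset ℕ → κ) (X : Finset ℕ), N ≤ X.card →
      ∃ Y ⊆ X, Y.card = b ∧ ∃ k, ∀ s ⊆ Y, s.card = a → c s = k := by
  classical
  induction a generalizing b with
  | zero =>
    refine ⟨b, fun c X hX => ?_⟩
    obtain ⟨Y, hY, hc⟩ := Finset.exists_subset_card_eq hX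
    exact ⟨Y, hY, hc, c ∅, fun s _ h => by rw [Finset.card_eq_zero.1 h]⟩
  | succ a ih =>
    -- A large subset is found on which the colour of an (a+1)-set depends only on its minimum;
    -- pigeonhole on the minima then finishes.
    have key : ∀ m : ℕ, ∃ N : ℕ, ∀ (c : Finset ℕ → κ) (X : Finset ℕ), N ≤ X.card →
        ∃ Y ⊆ X, Y.card = m ∧ ∃ d : ℕ → κ, ∀ x ∈ Y, ∀ s ⊆ Y, (∀ y ∈ s, x < y) →
          s.card = a → c (insert x s) = d x := by
      intro m
      induction m with
      | zero =>
        exact ⟨0, fun c X _ => ⟨∅, by simp, rfl, fun _ => Classical.arbitrary κ, by simp⟩⟩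
      | succ m ihm =>
        obtain ⟨M, hM⟩ := ihm
        obtain ⟨N, hN⟩ := ih M
        refine ⟨N + 1, fun c X hX => ?_⟩
        have hne : X.Nonempty := Finset.card_pos.1 (by omega)
        set x := X.min' hne
        obtain ⟨Y, hY, hYc, k, hk⟩ := hN (fun s => c (insert x s)) (X.erase x) (by
          rw [Finset.card_erase_of_mem (X.min'_mem hne)]; omega)
        obtain ⟨Z, hZ, hZc, d, hd⟩ := hM c Y hYc.ge
        have hlt : ∀ z ∈ Z, x < z := fun z hz => by
          have h := Finset.mem_erase.1 (hY (hZ hz))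
          exact lt_of_le_of_ne (X.min'_le z h.2) h.1.symm
        have hxZ : x ∉ Z := fun h => lt_irrefl _ (hlt x h)
        refine ⟨insert x Z, ?_, by rw [Finset.card_insert_of_notMem hxZ, hZc],
          Function.update d x k, ?_⟩
        · intro z hz
          rcases Finset.mem_insert.1 hz with rfl | hz
          · exact X.min'_mem hne
          · exact (Finset.mem_erase.1 (hY (hZ hz))).2
        · intro y hy s hs hys hsc
          have hle : ∀ z ∈ insert x Z, x ≤ z := fun z hz => by
            rcases Finset.mem_insert.1 hz with rfl | hz
            · exact le_rfl
            · exact (hlt z hz).le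
          have hsZ : s ⊆ Z := fun z hz => by
            rcases Finset.mem_insert.1 (hs hz) with h | h
            · exact absurd (hys z hz) (h ▸ (hle y hy).not_gt)
            · exact h
          rcases Finset.mem_insert.1 hy with rfl | hy
          · rw [Function.update_self]
            exact hk s (hsZ.trans hZ) hsc
          · rw [Function.update_of_ne (hlt y hy).ne']
            exact hd y hy s hsZ hys hsc
    have := Fintype.ofFinite κ
    obtain ⟨N, hN⟩ := key (Fintype.card κ * b)
    refine ⟨N, fun c X hX => ?_⟩
    obtain ⟨Y, hY, hYc, d, hd⟩ := hN c X hX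
    obtain ⟨k, -, hk⟩ := Finset.exists_le_card_fiber_of_mul_le_card_of_maps_to
      (s := Y) (t := Finset.univ) (f := d) (n := b) (fun _ _ => Finset.mem_univ _)
      Finset.univ_nonempty (by rw [hYc, Finset.card_univ])
    obtain ⟨Z, hZ, hZc⟩ := Finset.exists_subset_card_eq hk
    have hZY : Z ⊆ Y := hZ.trans (Finset.filter_subset _ _)
    refine ⟨Z, hZY.trans hY, hZc, k, fun s hs hsc => ?_⟩
    have hne : s.Nonempty := Finset.card_pos.1 (by omega)
    have hmem := s.min'_mem hne
    rw [← Finset.insert_erase hmem, hd _ (hZY (hs hmem)) _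
      ((Finset.erase_subset _ _).trans (hs.trans hZY)) (fun y hy => ?_)
      (by rw [Finset.card_erase_of_mem hmem]; omega)]
    · exact (Finset.mem_filter.1 (hZ (hs hmem))).2
    · have h := Finset.mem_erase.1 hy
      exact lt_of_le_of_ne (s.min'_le y h.2) h.1.symm

/-- The finite Ramsey theorem for colourings of increasing sequences. -/
theorem exists_homogeneous_strictMono (κ : Type*) [Finite κ] [Nonempty κ] (a b : ℕ) :
    ∃ N : ℕ, ∀ c : (Fin a → Fin N) → κ, ∃ g : Fin b → Fin N, StrictMono g ∧
      ∃ k, ∀ e : Fin a → Fin b, StrictMono e → c (g ∘ e) = k := by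
  classical
  obtain ⟨N, hN⟩ := exists_homogeneous_finset κ a b
  refine ⟨N, fun c => ?_⟩
  let c' : Finset ℕ → κ := fun s => if h : s.card = a ∧ ∀ x ∈ s, x < N then
    c fun i => ⟨s.orderEmbOfFin h.1 i, h.2 _ (s.orderEmbOfFin_mem h.1 i)⟩
    else Classical.arbitrary κ
  obtain ⟨Y, hY, hYc, k, hk⟩ := hN c' (Finset.range N) (by simp)
  have hYN : ∀ x ∈ Y, x < N := fun x hx => Finset.mem_range.1 (hY hx)
  refine ⟨fun i => ⟨Y.orderEmbOfFin hYc i, hYN _ (Y.orderEmbOfFin_mem hYc i)⟩,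
    fun i j h => (Y.orderEmbOfFin hYc).strictMono h, k, fun e he => ?_⟩
  have hmono : StrictMono fun i => Y.orderEmbOfFin hYc (e i) :=
    (Y.orderEmbOfFin hYc).strictMono.comp he
  let s : Finset ℕ := Finset.univ.image fun i => Y.orderEmbOfFin hYc (e i)
  have hs : s ⊆ Y := fun x hx => by
    obtain ⟨i, -, rfl⟩ := Finset.mem_image.1 hx
    exact Y.orderEmbOfFin_mem hYc _
  have hsc : s.card = a := by
    rw [Finset.card_image_of_injective _ hmono.injective, Finset.card_univ, Fintype.card_fin]
  have hsN : s.card = a ∧ ∀ x ∈ s, x < N := ⟨hsc, fun x hx => hYN x (hs hx)⟩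
  have heq := Finset.orderEmbOfFin_unique hsc
    (fun i => Finset.mem_image_of_mem _ (Finset.mem_univ i)) hmono
  rw [← hk s hs hsc]
  simp only [c', dif_pos hsN]
  congr 1
  funext i
  exact Fin.ext (congrFun heq i)

/-! ### The partite construction -/

section Partite

variable {I K κ : Type} [Finite I] [Nonempty K] [Finite κ] {a : ℕ}

/-- One step of the partite construction: the sections over a fixed `α` that realise the pattern
`χA` are made monochromatic. -/
theorem exists_section_mono (α : Fin a → I) (hα : Function.Injective α) (χA : Fin a → Fin a → K)
    (V : Type) [Finite V] (π : V → I) (χ : V → V → K) :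
    ∃ (W : Type) (_ : Finite W) (ρ : W → I) (ψ : W → W → K), ∀ c : (Fin a → W) → κ,
      ∃ f : V → W, (∀ v, ρ (f v) = π v) ∧ (∀ u v, ψ (f u) (f v) = χ u v) ∧
        ∃ k, ∀ e : Fin a → V, (∀ x, π (e x) = α x) → (∀ x y, χ (e x) (e y) = χA x y) →
          c (f ∘ e) = k := by
  classical
  -- The alphabet for Hales–Jewett consists of the sections to be made monochromatic.
  let E : Type := {e : Fin a → V // (∀ x, π (e x) = α x) ∧ ∀ x y, χ (e x) (e y) = χA x y}
  obtain ⟨ι, _, hι⟩ := Combinatorics.Line.exists_mono_in_high_dimension E κ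
  -- Each line yields a copy of V: active coordinates hold v itself, and a coordinate fixed at e
  -- holds the vertex of e in the fibre of v. The value `none` serves the fibres that α misses.
  let F : Combinatorics.Line E ι → V → I × (ι → Option V) := fun l v =>
    (π v, fun i => (l.idxFun i).elim (some v) fun e =>
      if h : ∃ x, α x = π v then some (e.1 h.choose) else none)
  have hnone : ∀ l v i, l.idxFun i = none → (F l v).2 i = some v := fun l v i h => by
    simp [F, h]
  have hsome : ∀ l v i e w, l.idxFun i = some e → (F l v).2 i = some w →
      ∃ x, α x = π v ∧ w = e.1 x := fun l v i e w h hw => by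
    simp only [F, h, Option.elim_some] at hw
    split_ifs at hw with hx
    exact ⟨hx.choose, hx.choose_spec, (Option.some.inj hw).symm⟩
  -- At an active coordinate of l the common images show u and v. There l' is either active too, so
  -- that the pairs coincide, or fixed at a section, which then contains both u and v.
  have hdich : ∀ l l' u v u' v', F l u = F l' u' → F l v = F l' v' → (u = u' ∧ v = v') ∨
      ∃ x y, α x = π u ∧ α y = π v ∧ χ u v = χA x y := by
    intro l l' u v u' v' hu hv
    obtain ⟨i, hi⟩ := l.proper
    have h1 := (congrFun (congrArg Prod.snd hu) i).symm.trans (hnone l u i hi)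
    have h2 := (congrFun (congrArg Prod.snd hv) i).symm.trans (hnone l v i hi)
    have hpu : π u = π u' := congrArg Prod.fst hu
    have hpv : π v = π v' := congrArg Prod.fst hv
    rcases hi' : l'.idxFun i with _ | e
    · rw [hnone _ _ _ hi'] at h1 h2
      exact Or.inl ⟨(Option.some.inj h1).symm, (Option.some.inj h2).symm⟩
    · obtain ⟨x, hx, rfl⟩ := hsome _ _ _ _ _ hi' h1
      obtain ⟨y, hy, rfl⟩ := hsome _ _ _ _ _ hi' h2
      exact Or.inr ⟨x, y, hx.trans hpu.symm, hy.trans hpv.symm, e.2.2 x y⟩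
  -- Copies may overlap without conflict: by the dichotomy applied both ways, distinct pairs with
  -- the same image both carry the colour prescribed by `χA`, at the same indices since α is
  -- injective.
  have hcons : ∀ l l' u v u' v', F l u = F l' u' → F l v = F l' v' → χ u v = χ u' v' := by
    intro l l' u v u' v' hu hv
    rcases hdich l l' u v u' v' hu hv with ⟨rfl, rfl⟩ | ⟨x, y, hx, hy, h⟩
    · rfl
    rcases hdich l' l u' v' u v hu.symm hv.symm with ⟨rfl, rfl⟩ | ⟨x', y', hx', hy', h'⟩
    · rfl
    have hpu : π u = π u' := congrArg Prod.fst hu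
    have hpv : π v = π v' := congrArg Prod.fst hv
    rw [h, h', hα (hx.trans (hpu.trans hx'.symm)), hα (hy.trans (hpv.trans hy'.symm))]
  let ψ : I × (ι → Option V) → I × (ι → Option V) → K := fun w w' =>
    if h : ∃ q : Combinatorics.Line E ι × V × V, F q.1 q.2.1 = w ∧ F q.1 q.2.2 = w' then
      χ h.choose.2.1 h.choose.2.2 else Classical.arbitrary K
  refine ⟨I × (ι → Option V), inferInstance, Prod.fst, ψ, fun c => ?_⟩
  -- A word of sections is read coordinatewise as a section of W. The image under `F l` of a section
  -- e is the point of l with parameter e.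
  obtain ⟨l, k, hk⟩ := hι fun w => c fun x => (α x, fun i => some ((w i).1 x))
  refine ⟨F l, fun v => rfl, fun u v => ?_, k, fun e he he' => ?_⟩
  · have h : ∃ q : Combinatorics.Line E ι × V × V, F q.1 q.2.1 = F l u ∧ F q.1 q.2.2 = F l v :=
      ⟨(l, u, v), rfl, rfl⟩
    simp only [ψ, dif_pos h]
    exact hcons _ _ _ _ _ _ h.choose_spec.1 h.choose_spec.2
  · rw [← hk ⟨e, he, he'⟩]
    congr 1
    funext x
    refine Prod.ext (he x) (funext fun i => ?_)
    rcases hi : l.idxFun i with _ | e'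
    · simp [F, hi]
    · have h : ∃ y, α y = π (e x) := ⟨x, (he x).symm⟩
      have hx : h.choose = x := hα (h.choose_spec.trans (he x))
      simp [F, hi, h, hx]

/-- The iterated partite construction: the sections for each member of a finite family of patterns
over given injections are made monochromatic. -/
theorem exists_sections_mono {τ : Type} (S : Finset τ) (α : τ → Fin a → I)
    (hα : ∀ t, Function.Injective (α t)) (χA : τ → Fin a → Fin a → K)
    (V : Type) [Finite V] (π : V → I) (χ : V → V → K) :
    ∃ (W : Type) (_ : Finite W) (ρ : W → I) (ψ : W → W → K), ∀ c : τ → (Fin a → W) → κ,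
      ∃ f : V → W, (∀ v, ρ (f v) = π v) ∧ (∀ u v, ψ (f u) (f v) = χ u v) ∧
        ∀ t ∈ S, ∃ k, ∀ e : Fin a → V, (∀ x, π (e x) = α t x) →
          (∀ x y, χ (e x) (e y) = χA t x y) → c t (f ∘ e) = k := by
  classical
  induction S using Finset.induction_on with
  | empty => exact ⟨V, ‹_›, π, χ, fun c => ⟨id, fun _ => rfl, fun _ _ => rfl, by simp⟩⟩
  | insert t S _ ih =>
    obtain ⟨W, _, ρ, ψ, hW⟩ := ih
    obtain ⟨W', hfin, ρ', ψ', hW'⟩ := exists_section_mono (κ := κ) (α t) (hα t) (χA t) W ρ ψ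
    refine ⟨W', hfin, ρ', ψ', fun c => ?_⟩
    -- The new pattern is stabilised first; the colourings for the others are pulled back along f,
    -- and passing to a smaller copy keeps the first pattern monochromatic.
    obtain ⟨f, hf1, hf2, k, hk⟩ := hW' (c t)
    obtain ⟨g, hg1, hg2, hg⟩ := hW fun s e => c s (f ∘ e)
    refine ⟨f ∘ g, fun v => (hf1 _).trans (hg1 v), fun u v => (hf2 _ _).trans (hg2 u v), ?_⟩
    intro s hs
    rcases Finset.mem_insert.1 hs with rfl | hs
    · exact ⟨k, fun e he he' => hk (g ∘ e) (fun x => (hg1 _).trans (he x))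
        fun x y => (hg2 _ _).trans (he' x y)⟩
    · exact hg s hs

/-- A finite type can be enumerated so that a given function into a linear order is monotone. -/
theorem exists_equiv_fin_of_lt (V : Type*) [Finite V] {γ : Type*} [LinearOrder γ] (key : V → γ) :
    ∃ (m : ℕ) (φ : V ≃ Fin m), ∀ u v, key u < key v → φ u < φ v := by
  obtain ⟨m, ⟨φ⟩⟩ := Finite.exists_equiv_fin V
  refine ⟨m, φ.trans (Tuple.sort (key ∘ φ.symm)).symm, fun u v h => ?_⟩
  have hm := Tuple.monotone_sort (key ∘ φ.symm)
  refine hm.reflect_lt ?_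
  simpa using h

/-- The Ramsey theorem for finite linear orders with an arbitrary colouring of all pairs, for a
finite family of patterns of the same size. -/
theorem exists_pattern_mono [Nonempty κ] {τ : Type} [Finite τ] {b : ℕ} (χA : τ → Fin a → Fin a → K)
    (χB : Fin b → Fin b → K) :
    ∃ (m : ℕ) (χC : Fin m → Fin m → K), ∀ c : τ → (Fin a → Fin m) → κ,
      ∃ f : Fin b → Fin m, StrictMono f ∧ (∀ x y, χC (f x) (f y) = χB x y) ∧
        ∀ t, ∃ k, ∀ e : Fin a → Fin b, StrictMono e →
          (∀ x y, χB (e x) (e y) = χA t x y) → c t (f ∘ e) = k := by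
  classical
  obtain ⟨N, hN⟩ := exists_homogeneous_strictMono (τ → κ) a b
  let σ : Type := τ × (Fin a ↪o Fin N)
  have : Finite σ := inferInstance
  have := Fintype.ofFinite σ
  -- The initial system has one transversal copy of B for each increasing map to `Fin N`; pairs from
  -- different copies are coloured as if they lay in one copy.
  obtain ⟨W, _, ρ, ψ, hW⟩ := exists_sections_mono (κ := κ) (Finset.univ : Finset σ)
    (fun t => t.2) (fun t => t.2.injective) (fun t => χA t.1)
    ((Fin b ↪o Fin N) × Fin b) (fun v => v.1 v.2) (fun u v => χB u.2 v.2)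
  obtain ⟨m, φ, hφ⟩ := exists_equiv_fin_of_lt W ρ
  refine ⟨m, fun x y => ψ (φ.symm x) (φ.symm y), fun c => ?_⟩
  obtain ⟨f, hf1, hf2, hf⟩ := hW fun t e => c t.1 (φ ∘ e)
  have hf' := fun t => hf t (Finset.mem_univ t)
  choose d hd using hf'
  -- All patterns are handled at once by colouring an increasing tuple with the function t ↦ `d (t,
  -- α)`. The default on other tuples is never used.
  obtain ⟨g, hg, k, hk⟩ := hN fun α t => if h : StrictMono α then
    d (t, OrderEmbedding.ofStrictMono α h) else Classical.arbitrary κ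
  let g' := OrderEmbedding.ofStrictMono g hg
  refine ⟨fun i => φ (f (g', i)), fun i j hij => hφ _ _ ?_, fun x y => ?_, fun t => ⟨k t, ?_⟩⟩
  · rw [hf1, hf1]
    exact hg hij
  · simp [hf2]
  · intro e he hχ
    have h := hd (t, OrderEmbedding.ofStrictMono (g ∘ e) (hg.comp he)) (fun x => (g', e x))
      (fun x => rfl) hχ
    have hk' := congrFun (hk e he) t
    simp only [dif_pos (hg.comp he)] at hk'
    rw [← hk', ← h]
    rfl

end Partite

/-! ### The generic complete partite digraph and its labelling by parts -/

section Generic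

variable {n : ℕ} {M : Type w} [FirstOrder.Language.graph.Structure M]

theorem nonEdge_embedding {T U : Type*} [FirstOrder.Language.graph.Structure T]
    [FirstOrder.Language.graph.Structure U] (f : T ↪[FirstOrder.Language.graph] U) (x y : T) :
    NonEdge (f x) (f y) ↔ NonEdge x y := by
  unfold NonEdge
  rw [GenericVertex.edge_embedding, GenericVertex.edge_embedding]

/-- Asymmetry and transitivity of non-adjacency involve at most three vertices, so they pass from
the members of the age to the limit. -/
theorem IsGenericPartite.exists_finite_substructure [Countable M] (hM : IsGenericPartite M n)
    {s : Set M} (hs : s.Finite) : ∃ S : FirstOrder.Language.graph.Substructure M,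
      s ⊆ S ∧ IsCompletePartite S n := by
  have hS := Substructure.fg_closure (L := FirstOrder.Language.graph) hs
  refine ⟨_, Substructure.subset_closure, ?_⟩
  have h : Bundled.of (c := FirstOrder.Language.graph.Structure)
      ↥(Substructure.closure FirstOrder.Language.graph s) ∈
      FirstOrder.Language.graph.age M :=
    ⟨(Substructure.fg_iff_structure_fg _).1 hS, ⟨Substructure.subtype _⟩⟩
  rw [hM.age] at h
  exact h.2

theorem IsGenericPartite.asymm [Countable M] (hM : IsGenericPartite M n) {x y : M}
    (h : Edge x y) : ¬ Edge y x := by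
  obtain ⟨S, hs, hS⟩ := hM.exists_finite_substructure (Set.toFinite {x, y})
  have hx : x ∈ S := hs (by simp)
  have hy : y ∈ S := hs (by simp)
  have := hS.asymm ⟨x, hx⟩ ⟨y, hy⟩
  rw [← GenericVertex.edge_embedding S.subtype, ← GenericVertex.edge_embedding S.subtype] at this
  exact this h

theorem IsGenericPartite.equivalence [Countable M] (hM : IsGenericPartite M n) :
    Equivalence (NonEdge : M → M → Prop) := by
  refine ⟨fun x => ?_, fun h => ⟨h.2, h.1⟩, fun {x y z} h h' => ?_⟩
  · exact ⟨fun h => hM.asymm h h, fun h => hM.asymm h h⟩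
  · obtain ⟨S, hs, hS⟩ := hM.exists_finite_substructure (Set.toFinite {x, y, z})
    have hx : x ∈ S := hs (by simp)
    have hy : y ∈ S := hs (by simp)
    have hz : z ∈ S := hs (by simp)
    have := @hS.equiv.trans ⟨x, hx⟩ ⟨y, hy⟩ ⟨z, hz⟩
    rw [← nonEdge_embedding S.subtype, ← nonEdge_embedding S.subtype,
      ← nonEdge_embedding S.subtype] at this
    exact this h h'

variable (n M) in
/-- `lab` sends each vertex to the index of its part. -/
structure IsLabelling [(partOrder n).Structure M] (lab : M → Fin n) : Prop where
  part_iff : ∀ i x, Part i x ↔ lab x = i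
  nonEdge_iff : ∀ x y, NonEdge x y ↔ lab x = lab y
  edge_iff : ∀ x y, lab x ≠ lab y → (Edge x y ↔ ¬ Edge y x)

theorem IsConvexPartExpansion.exists_isLabelling [Countable M] [(partOrder n).Structure M]
    (hM : IsGenericPartite M n) (hM' : IsConvexPartExpansion n M) :
    ∃ lab : M → Fin n, IsLabelling n M lab := by
  choose lab hlab huniq using hM'.existsUnique_part
  have hpart : ∀ i x, Part i x ↔ lab x = i := fun i x =>
    ⟨fun h => (huniq x i h).symm, fun h => h ▸ hlab x⟩
  have hnon : ∀ x y, NonEdge x y ↔ lab x = lab y := fun x y => by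
    obtain ⟨z, hz⟩ := hM'.part_eq_class (lab x)
    have hzx := (hz x).1 (hlab x)
    rw [eq_comm, ← hpart, hz]
    exact ⟨hM.equivalence.trans hzx, hM.equivalence.trans (hM.equivalence.symm hzx)⟩
  refine ⟨lab, hpart, hnon, fun x y h => ⟨hM.asymm, fun h' => ?_⟩⟩
  by_contra h''
  exact h ((hnon x y).1 ⟨h'', h'⟩)

/-- The digraph structure on `Fin n × Fin m` with the parts `{i} × Fin m` and edges prescribed by
`E`. -/
@[reducible] def partiteStructure {m : ℕ} (E : Fin m → Fin m → Prop) :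
    FirstOrder.Language.graph.Structure (ULift.{w} (Fin n × Fin m)) where
  RelMap | .adj => fun x => ((x 0).down.1 < (x 1).down.1 ∧ E (x 0).down.2 (x 1).down.2) ∨
    ((x 1).down.1 < (x 0).down.1 ∧ ¬ E (x 1).down.2 (x 0).down.2)

/-- A finite digraph on labelled vertices is found in the generic partite digraph, with the
labels. -/
theorem IsGenericPartite.exists_realization [Countable M] [(partOrder n).Structure M]
    (hM : IsGenericPartite M n) {lab : M → Fin n} (hlab : IsLabelling n M lab) {m : ℕ}
    (l : Fin m → Fin n) (E : Fin m → Fin m → Prop)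
    (hE : ∀ x y, l x ≠ l y → (E x y ↔ ¬ E y x)) :
    ∃ h : Fin m → M, Function.Injective h ∧ (∀ x, lab (h x) = l x) ∧
      ∀ x y, l x ≠ l y → (Edge (h x) (h y) ↔ E x y) := by
  rcases Nat.eq_zero_or_pos m with rfl | hm
  · exact ⟨fun x => x.elim0, fun x => x.elim0, fun x => x.elim0, fun x => x.elim0⟩
  -- All n parts are included, even those l does not use, so that an embedding must meet every part
  -- of M.
  let := partiteStructure.{w} (n := n) E
  let T := ULift.{w} (Fin n × Fin m)
  have hedge : ∀ u v : T, Edge u v ↔ (u.down.1 < v.down.1 ∧ E u.down.2 v.down.2) ∨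
    (v.down.1 < u.down.1 ∧ ¬ E v.down.2 u.down.2) := fun _ _ => Iff.rfl
  have hnon : ∀ u v : T, NonEdge u v ↔ u.down.1 = v.down.1 := fun u v => by
    unfold NonEdge
    rw [hedge, hedge]
    rcases lt_trichotomy u.down.1 v.down.1 with h | h | h
    · simp [h, h.not_gt, h.ne]
    · simp [h]
    · simp [h, h.not_gt, h.ne']
  have hasymm : ∀ u v : T, Edge u v → ¬ Edge v u := fun u v => by
    rw [hedge, hedge]
    rintro (⟨h, h'⟩ | ⟨h, h'⟩) <;> simp [h, h', h.not_gt]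
  have heq : Equivalence (NonEdge : T → T → Prop) :=
    ⟨fun x => (hnon x x).2 rfl, fun {x y} h => (hnon y x).2 ((hnon x y).1 h).symm,
      fun {x y z} h h' => (hnon x z).2 (((hnon x y).1 h).trans ((hnon y z).1 h'))⟩
  have hT : IsCompletePartite T n := by
    refine ⟨hasymm, heq, ?_⟩
    have hinj : Function.Injective (Quotient.lift (s := Setoid.mk NonEdge heq)
        (fun x : T => x.down.1) fun x y h => (hnon x y).1 h) := by
      intro a b
      induction a using Quotient.inductionOn
      induction b using Quotient.inductionOn
      intro h
      exact Quotient.sound ((hnon _ _).2 h)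
    simpa using ENat.card_le_card_of_injective hinj
  have hage : Bundled.of (c := FirstOrder.Language.graph.Structure) T ∈
      FirstOrder.Language.graph.age M := by
    rw [hM.age]
    exact ⟨inferInstanceAs (Finite T), hT⟩
  obtain ⟨-, ⟨g⟩⟩ := hage
  change T ↪[FirstOrder.Language.graph] M at g
  have hg : ∀ u v : T, lab (g u) = lab (g v) ↔ u.down.1 = v.down.1 := fun u v => by
    rw [← hlab.nonEdge_iff, nonEdge_embedding, hnon]
  -- The embedding may permute the parts. This permutation is inverted by σ, and x is placed in part
  -- `σ (l x)` to end up with label `l x`.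
  have hinj : Function.Injective fun i : Fin n => lab (g ⟨(i, ⟨0, hm⟩)⟩) :=
    fun i j h => (hg _ _).1 h
  choose σ hσ using Finite.surjective_of_injective hinj
  have hlabel : ∀ x, lab (g ⟨(σ (l x), x)⟩) = l x := fun x => by
    rw [← hσ (l x), hg, hσ]
  refine ⟨fun x => g ⟨(σ (l x), x)⟩, fun x y h => ?_, hlabel, fun x y hxy => ?_⟩
  · exact congrArg (fun u : T => u.down.2) (g.injective h)
  · have hne : σ (l x) ≠ σ (l y) := fun h => hxy (by
      have h1 := hσ (l x)
      rw [h] at h1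
      exact h1.symm.trans (hσ (l y)))
    rw [GenericVertex.edge_embedding, hedge]
    rcases lt_or_gt_of_ne hne with h | h
    · simp [h, h.not_gt]
    · simp only [h, h.not_gt, false_and, true_and, false_or]
      exact (hE x y hxy).symm

end Generic

/-! ### Patterns: labelled edge relations as colourings of pairs -/

section Pattern

variable {n m b : ℕ}

/-- The colouring of pairs that records the labels and the edges to higher labels. -/
def pattern (l : Fin m → Fin n) (E : Fin m → Fin m → Prop) (x y : Fin m) : Fin n × Prop :=
  (l x, l x < l y ∧ E x y)

/-- The labels recorded on the diagonal. -/
def patternLabel (χ : Fin m → Fin m → Fin n × Prop) (x : Fin m) : Fin n := (χ x x).1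

/-- The edge relation recorded by a colouring of pairs. -/
def patternEdge (χ : Fin m → Fin m → Fin n × Prop) (x y : Fin m) : Prop :=
  (patternLabel χ x < patternLabel χ y ∧ (χ x y).2) ∨
    (patternLabel χ y < patternLabel χ x ∧ ¬ (χ y x).2)

/-- This holds for every χ, so any colouring delivered by the pattern theorem can be realised as a
digraph. -/
theorem patternEdge_iff_not (χ : Fin m → Fin m → Fin n × Prop) (x y : Fin m)
    (h : patternLabel χ x ≠ patternLabel χ y) :
    patternEdge χ x y ↔ ¬ patternEdge χ y x := by
  unfold patternEdge
  rcases lt_or_gt_of_ne h with h | h <;> simp [h, h.not_gt]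

theorem patternLabel_comp {χ : Fin m → Fin m → Fin n × Prop} {f : Fin b → Fin m}
    {l : Fin b → Fin n} {E : Fin b → Fin b → Prop}
    (hf : ∀ x y, χ (f x) (f y) = pattern l E x y) (x : Fin b) : patternLabel χ (f x) = l x := by
  simp [patternLabel, hf, pattern]

/-- The colouring keeps E only from lower to higher labels; `hE` recovers the other direction by
negation. -/
theorem patternEdge_comp {χ : Fin m → Fin m → Fin n × Prop} {f : Fin b → Fin m}
    {l : Fin b → Fin n} {E : Fin b → Fin b → Prop} (hE : ∀ x y, l x ≠ l y → (E x y ↔ ¬ E y x))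
    (hf : ∀ x y, χ (f x) (f y) = pattern l E x y) (x y : Fin b) (hxy : l x ≠ l y) :
    patternEdge χ (f x) (f y) ↔ E x y := by
  simp only [patternEdge, patternLabel_comp hf, hf, pattern]
  rcases lt_or_gt_of_ne hxy with h | h
  · simp [h, h.not_gt]
  · simp [h, h.not_gt, hE x y hxy]

end Pattern

/-! ### The ordering property -/

section Ordering

variable {n : ℕ} {M : Type w} [FirstOrder.Language.graph.Structure M] [(partOrder n).Structure M]

theorem IsConvexPartExpansion.asymm (hM' : IsConvexPartExpansion n M) {x y : M} (h : Lt n x y) :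
    ¬ Lt n y x := fun h' => hM'.irrefl x (hM'.trans _ _ _ h h')

/-- A finite digraph on labelled and linearly ordered vertices is found in the ordered generic
partite digraph, with the labels and with the order inside each part. -/
theorem exists_ordered_realization [Countable M] [Nonempty (Fin n)] (hM : IsGenericPartite M n)
    (hM' : IsConvexPartExpansion n M) {lab : M → Fin n} (hlab : IsLabelling n M lab) {b : ℕ}
    (l : Fin b → Fin n) (E : Fin b → Fin b → Prop)
    (hE : ∀ x y, l x ≠ l y → (E x y ↔ ¬ E y x)) :
    ∃ h : Fin b → M, Function.Injective h ∧ (∀ x, lab (h x) = l x) ∧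
      (∀ x y, l x ≠ l y → (Edge (h x) (h y) ↔ E x y)) ∧
      ∀ x y, l x = l y → x < y → Lt n (h x) (h y) := by
  classical
  -- In the copy indexed by ε, part i keeps its order if `ε i` is true and is reversed otherwise.
  obtain ⟨d, φ, hφ⟩ := exists_equiv_fin_of_lt ((Fin n → Bool) × Fin b)
    (fun u => if u.1 (l u.2) then (u.2 : ℕ) else b - u.2)
  let lD : Fin d → Fin n := fun u => l (φ.symm u).2
  let ED : Fin d → Fin d → Prop := fun u v => E (φ.symm u).2 (φ.symm v).2
  -- The i-th pattern is that of two vertices in part i: with equal labels the second component is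
  -- always false.
  obtain ⟨m, χ, hχ⟩ := exists_pattern_mono (κ := Bool)
    (fun (i : Fin n) (_ _ : Fin 2) => ((i, False) : Fin n × Prop)) (pattern lD ED)
  obtain ⟨h, hinj, hl, hedge⟩ := hM.exists_realization hlab (patternLabel χ) (patternEdge χ)
    (patternEdge_iff_not χ)
  obtain ⟨f, hf, hfχ, hmono⟩ := hχ fun _ e => decide (Lt n (h (e 0)) (h (e 1)))
  choose ε hε using hmono
  have hpair : ∀ u v : Fin d, u < v → lD u = lD v → (Lt n (h (f u)) (h (f v)) ↔ ε (lD u)) := by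
    intro u v huv huv'
    have := hε (lD u) ![u, v] (by
      intro i j hij
      fin_cases i <;> fin_cases j <;> first | exact huv | exact absurd hij (by decide)) (by
      intro i j
      fin_cases i <;> fin_cases j <;> simp [pattern, huv'])
    rw [← this]
    simp
  have hED : ∀ u v, lD u ≠ lD v → (ED u v ↔ ¬ ED v u) := fun u v => hE _ _
  have hlD : ∀ x, lD (φ (ε, x)) = l x := fun x => by simp [lD]
  refine ⟨fun x => h (f (φ (ε, x))), fun x y hxy => ?_, fun x => ?_, fun x y hxy => ?_,
    fun x y hxy hlt => ?_⟩
  · exact congrArg Prod.snd (φ.injective (hf.injective (hinj hxy)))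
  · rw [hl, patternLabel_comp hfχ, hlD]
  · have hne : lD (φ (ε, x)) ≠ lD (φ (ε, y)) := by rwa [hlD, hlD]
    rw [hedge _ _ (by rwa [patternLabel_comp hfχ, patternLabel_comp hfχ]),
      patternEdge_comp hED hfχ _ _ hne]
    simp [ED]
  · have hxb := x.isLt
    have hyb := y.isLt
    have hlt' : (x : ℕ) < y := hlt
    -- If M reverses the part, the copy indexed by ε is reversed there as well, and the two
    -- reversals cancel.
    rcases hε' : ε (l x) with _ | _
    · have h1 : φ (ε, y) < φ (ε, x) := hφ _ _ (by simp [← hxy, hε']; omega)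
      have h2 := (hpair _ _ h1 (by rw [hlD, hlD, hxy])).not.2 (by rw [hlD, ← hxy, hε']; simp)
      rcases hM'.total (h (f (φ (ε, x)))) (h (f (φ (ε, y)))) with h3 | h3 | h3
      · exact h3
      · exact absurd (hf.injective (hinj h3)) h1.ne'
      · exact absurd h3 h2
    · have h1 : φ (ε, x) < φ (ε, y) := hφ _ _ (by simp [← hxy, hε', hlt])
      exact (hpair _ _ h1 (by rw [hlD, hlD, hxy])).2 (by rw [hlD, hε'])

end Ordering

/-! ### Structures embedded into the expansion -/

section Embedded

variable {n : ℕ} {M : Type w} [FirstOrder.Language.graph.Structure M] [(partOrder n).Structure M]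
  {X Y : Type*} [(expandedLanguage n).Structure X] [(expandedLanguage n).Structure Y]

variable (n) in
/-- The symbol for edges in the expanded language. -/
def edgeSymbol : (expandedLanguage n).Relations 2 := Sum.inl FirstOrder.Language.adj

variable (n) in
/-- The symbol for the order in the expanded language. -/
def ltSymbol : (expandedLanguage n).Relations 2 := Sum.inr PartOrderRel.lt

/-- The symbol for the `p`-th part in the expanded language. -/
def partSymbol (p : Fin n) : (expandedLanguage n).Relations 1 := Sum.inr (PartOrderRel.part p)

theorem edge_iff_of_embedding (i : X ↪[expandedLanguage n] M) (x y : X) :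
    Edge (i x) (i y) ↔ RelMap (edgeSymbol n) ![x, y] := by
  rw [← i.map_rel, show i ∘ ![x, y] = ![i x, i y] by funext j; fin_cases j <;> rfl]
  rfl

theorem lt_iff_of_embedding (i : X ↪[expandedLanguage n] M) (x y : X) :
    Lt n (i x) (i y) ↔ RelMap (ltSymbol n) ![x, y] := by
  rw [← i.map_rel, show i ∘ ![x, y] = ![i x, i y] by funext j; fin_cases j <;> rfl]
  rfl

theorem part_iff_of_embedding (i : X ↪[expandedLanguage n] M) (p : Fin n) (x : X) :
    Part p (i x) ↔ RelMap (partSymbol p) ![x] := by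
  rw [← i.map_rel, show i ∘ ![x] = ![i x] by funext j; fin_cases j; rfl]
  rfl

/-- A bijection between two structures embedded into the expansion that preserves parts, edges and
the order is an isomorphism. -/
theorem nonempty_equiv_of_embeddings (i : X ↪[expandedLanguage n] M)
    (j : Y ↪[expandedLanguage n] M) (φ : X ≃ Y)
    (hpart : ∀ (p : Fin n) x, Part p (j (φ x)) ↔ Part p (i x))
    (hedge : ∀ x y, Edge (j (φ x)) (j (φ y)) ↔ Edge (i x) (i y))
    (hlt : ∀ x y, Lt n (j (φ x)) (j (φ y)) ↔ Lt n (i x) (i y)) :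
    Nonempty (X ≃[expandedLanguage n] Y) := by
  have two : ∀ {Z : Type _} (z : Fin 2 → Z), z = ![z 0, z 1] := fun z => by
    funext k; fin_cases k <;> rfl
  have two' : ∀ z : Fin 2 → X, φ ∘ z = ![φ (z 0), φ (z 1)] := fun z => by
    funext k; fin_cases k <;> rfl
  refine ⟨⟨φ, fun f => isEmptyElim f, ?_⟩⟩
  rintro k (r | r) z
  · change graphRel k at r
    cases r
    have := hedge (z 0) (z 1)
    rw [edge_iff_of_embedding, edge_iff_of_embedding, ← two] at this
    change RelMap _ (φ ∘ z) ↔ _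
    rw [two']
    exact this
  change PartOrderRel n k at r
  rcases r with ⟨p⟩ | _
  · have := hpart p (z 0)
    rw [part_iff_of_embedding, part_iff_of_embedding] at this
    change RelMap _ (φ ∘ z) ↔ _
    rw [show φ ∘ z = ![φ (z 0)] by funext k; fin_cases k; rfl,
      show z = ![z 0] by funext k; fin_cases k; rfl]
    exact this
  · have := hlt (z 0) (z 1)
    rw [lt_iff_of_embedding, lt_iff_of_embedding, ← two] at this
    change RelMap _ (φ ∘ z) ↔ _
    rw [two']
    exact this

theorem mem_closure_range {Z V : Type*} [(expandedLanguage n).Structure Z] {q : V → Z} {z : Z} :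
    z ∈ Substructure.closure (expandedLanguage n) (Set.range q) ↔ ∃ v, q v = z :=
  Substructure.mem_closure_iff_of_isRelational _ _ _

variable (n) in
/-- Two sequences of elements of the expansion have the same parts, edges and order. -/
structure SameType {b : ℕ} (p q : Fin b → M) : Prop where
  part : ∀ (i : Fin n) x, Part i (q x) ↔ Part i (p x)
  edge : ∀ x y, Edge (q x) (q y) ↔ Edge (p x) (p y)
  lt : ∀ x y, Lt n (q x) (q y) ↔ Lt n (p x) (p y)

end Embedded

/-! ### Increasing enumerations and their types -/

section Enumeration

variable {n : ℕ} {M : Type w} [FirstOrder.Language.graph.Structure M] [(partOrder n).Structure M]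

/-- A finite structure embedded into the expansion is enumerated increasingly. -/
theorem IsConvexPartExpansion.exists_enumeration (hM' : IsConvexPartExpansion n M) {X : Type*}
    [Finite X] (i : X → M) (hi : Function.Injective i) :
    ∃ (m : ℕ) (φ : X ≃ Fin m), ∀ x y, Lt n (i (φ.symm x)) (i (φ.symm y)) ↔ x < y := by
  classical
  have : IsStrictTotalOrder M (Lt n) :=
    { irrefl := hM'.irrefl
      trans := hM'.trans
      trichotomous := fun x y h h' => by
        rcases hM'.total x y with h1 | h1 | h1
        · exact absurd h1 h
        · exact h1
        · exact absurd h1 h' }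
  let := linearOrderOfSTO (Lt n (V := M))
  obtain ⟨m, φ, hφ⟩ := exists_equiv_fin_of_lt X i
  have hφ' : ∀ x y, Lt n (i x) (i y) → φ x < φ y := hφ
  refine ⟨m, φ, fun x y => ⟨fun h => by simpa using hφ' _ _ h, fun h => ?_⟩⟩
  rcases hM'.total (i (φ.symm x)) (i (φ.symm y)) with h1 | h1 | h1
  · exact h1
  · exact absurd (φ.symm.injective (hi h1)) h.ne
  · exact absurd (by simpa using hφ' _ _ h1) h.not_gt

/-- An increasing realisation of the pattern of an increasing sequence has the same type. -/
theorem sameType_of_pattern (hM' : IsConvexPartExpansion n M) {lab : M → Fin n}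
    (hlab : IsLabelling n M lab) {b : ℕ} {p q : Fin b → M}
    (hp : ∀ x y, Lt n (p x) (p y) ↔ x < y) (hl : ∀ x, lab (q x) = lab (p x))
    (hedge : ∀ x y, lab (p x) ≠ lab (p y) → (Edge (q x) (q y) ↔ Edge (p x) (p y)))
    (hlt : ∀ x y, lab (p x) = lab (p y) → x < y → Lt n (q x) (q y)) : SameType n p q := by
  have hmono : ∀ x y, x < y → Lt n (q x) (q y) := fun x y hxy => by
    rcases lt_trichotomy (lab (p x)) (lab (p y)) with h | h | h
    · exact hM'.part_lt _ _ h _ _ ((hlab.part_iff _ _).2 (hl x)) ((hlab.part_iff _ _).2 (hl y))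
    · exact hlt x y h hxy
    -- Labels cannot decrease along p, since p is increasing and the parts are ordered by index.
    · exact absurd ((hp x y).2 hxy) (hM'.asymm (hM'.part_lt _ _ h _ _
        ((hlab.part_iff _ _).2 rfl) ((hlab.part_iff _ _).2 rfl)))
  refine ⟨fun i x => by rw [hlab.part_iff, hlab.part_iff, hl], fun x y => ?_, fun x y => ?_⟩
  · by_cases h : lab (p x) = lab (p y)
    · have h1 := (hlab.nonEdge_iff _ _).2 h
      have h2 := (hlab.nonEdge_iff (q x) (q y)).2 (by rw [hl, hl, h])
      exact ⟨fun h' => absurd h' h2.1, fun h' => absurd h' h1.1⟩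
    · exact hedge x y h
  · rw [hp]
    refine ⟨fun h => ?_, hmono x y⟩
    rcases lt_trichotomy x y with h1 | rfl | h1
    · exact h1
    · exact absurd h (hM'.irrefl _)
    · exact absurd h (hM'.asymm (hmono y x h1))

end Enumeration

/-! ### The Ramsey property of the age -/

/-- Over an empty expansion the Ramsey property is trivial. -/
theorem ramseyProperty_age_of_isEmpty {L : FirstOrder.Language.{u, v}} (M : Type w) [L.Structure M]
    [IsEmpty M] : RamseyProperty (L.age M) := by
  intro k A _ B hB
  refine ⟨B, hB, fun c => ⟨⊤, ⟨Substructure.topEquiv⟩, fun A₁ A₂ _ _ => ?_⟩⟩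
  obtain ⟨i⟩ := hB.2
  have : IsEmpty B := Function.isEmpty i
  congr 1
  exact Subtype.ext (Substructure.ext fun x => isEmptyElim x)

/-- The age of the expansion of the generic complete partite digraph by its parts and a convex
linear order has the Ramsey property. -/
theorem IsGenericPartite.ramseyProperty_age {n : ℕ} {M : Type w} [Countable M]
    [FirstOrder.Language.graph.Structure M] (hM : IsGenericPartite M n)
    [(partOrder n).Structure M] (hM' : IsConvexPartExpansion n M) :
    RamseyProperty ((expandedLanguage n).age M) := by
  classical
  rcases isEmpty_or_nonempty M with hemp | ⟨⟨x₀⟩⟩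
  · exact ramseyProperty_age_of_isEmpty M
  -- The pattern theorem needs a nonempty set `Fin n × Prop` of pair colours.
  have : Nonempty (Fin n) := ⟨(hM'.existsUnique_part x₀).choose⟩
  obtain ⟨lab, hlab⟩ := hM'.exists_isLabelling hM
  rintro k A ⟨hAfg, ⟨iA⟩⟩ B ⟨hBfg, ⟨iB⟩⟩
  have : Finite A := Structure.fg_iff_finite.1 hAfg
  have : Finite B := Structure.fg_iff_finite.1 hBfg
  obtain ⟨a, φA, hφA⟩ := hM'.exists_enumeration iA iA.injective
  obtain ⟨b, φB, hφB⟩ := hM'.exists_enumeration iB iB.injective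
  let α : Fin a → M := fun x => iA (φA.symm x)
  let β : Fin b → M := fun x => iB (φB.symm x)
  obtain ⟨m, χ, hχ⟩ := exists_pattern_mono (κ := Fin (k + 1))
    (fun _ : Unit => pattern (fun x => lab (α x)) fun x y => Edge (α x) (α y))
    (pattern (fun x => lab (β x)) fun x y => Edge (β x) (β y))
  obtain ⟨h, hinj, hl, hedge, hlt⟩ := exists_ordered_realization hM hM' hlab (patternLabel χ)
    (patternEdge χ) (patternEdge_iff_not χ)
  let S := Substructure.closure (expandedLanguage n) (Set.range h)
  have hSfg : S.FG := Substructure.fg_closure (Set.finite_range h)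
  let hC : Fin m → S := fun x => ⟨h x, mem_closure_range.2 ⟨x, rfl⟩⟩
  let sub (q : ℕ) (e : Fin q → Fin m) : (expandedLanguage n).Substructure S :=
    Substructure.closure (expandedLanguage n) (Set.range (hC ∘ e))
  refine ⟨Bundled.of (c := (expandedLanguage n).Structure) S,
    ⟨(Substructure.fg_iff_structure_fg _).1 hSfg, ⟨S.subtype⟩⟩, fun c => ?_⟩
  change Copies (expandedLanguage n) S A → Fin k at c
  change ∃ B' ∈ Copies (expandedLanguage n) S B, ∀ A₁ A₂ : Copies (expandedLanguage n) S A,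
    A₁.1 ≤ B' → A₂.1 ≤ B' → c A₁ = c A₂
  -- The extra colour `Fin.last k` marks tuples that do not span a copy of A; it also keeps the
  -- palette nonempty when k = 0.
  obtain ⟨f, hf, hfχ, hmono⟩ := hχ fun _ e => if H : sub a e ∈ Copies (expandedLanguage n) S A then
    (c ⟨sub a e, H⟩).castSucc else Fin.last k
  obtain ⟨col, hcol⟩ := hmono ()
  have hsame : SameType n β (h ∘ f) := by
    refine sameType_of_pattern hM' hlab hφB (fun x => ?_) (fun x y hxy => ?_) fun x y hxy hlt' => ?_
    · exact (hl _).trans (patternLabel_comp hfχ x)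
    · have h1 := patternEdge_comp (fun x y h' => hlab.edge_iff (β x) (β y) h') hfχ x y hxy
      exact (hedge _ _ (by rwa [patternLabel_comp hfχ, patternLabel_comp hfχ])).trans h1
    · exact hlt _ _ (by rwa [patternLabel_comp hfχ, patternLabel_comp hfχ]) (hf hlt')
  refine ⟨sub b f, ?_, ?_⟩
  · let q : Fin b → sub b f := fun x => ⟨hC (f x), mem_closure_range.2 ⟨x, rfl⟩⟩
    have hq : Function.Bijective q := by
      refine ⟨fun x y hxy => hf.injective (hinj ?_), fun ⟨z, hz⟩ => ?_⟩
      · exact congrArg (fun z : sub b f => (z.1 : M)) hxy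
      · obtain ⟨x, hx⟩ := mem_closure_range.1 hz
        exact ⟨x, Subtype.ext hx⟩
    obtain ⟨ψ⟩ := nonempty_equiv_of_embeddings iB (S.subtype.comp (sub b f).subtype)
      (φB.trans (Equiv.ofBijective q hq))
      (fun p x => by simpa [β] using hsame.part p (φB x))
      (fun x y => by simpa [β] using hsame.edge (φB x) (φB y))
      (fun x y => by simpa [β] using hsame.lt (φB x) (φB y))
    exact ⟨ψ.symm⟩
  · suffices H : ∀ A₁ : Copies (expandedLanguage n) S A, A₁.1 ≤ sub b f → (c A₁).castSucc = col from
      fun A₁ A₂ h₁ h₂ => Fin.castSucc_injective _ ((H A₁ h₁).trans (H A₂ h₂).symm)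
    rintro ⟨A₁, hA₁⟩ hle
    obtain ⟨ψ⟩ := hA₁
    have hex : ∀ x : Fin a, ∃ y : Fin b, hC (f y) = (ψ.symm (φA.symm x)).1 := fun x =>
      mem_closure_range.1 (hle (ψ.symm (φA.symm x)).2)
    choose e he using hex
    let j : A ↪[expandedLanguage n] M := (S.subtype.comp A₁.subtype).comp ψ.symm.toEmbedding
    have hj : ∀ x, h (f (e x)) = j (φA.symm x) := fun x => congrArg Subtype.val (he x)
    have hlabe : ∀ x, lab (β (e x)) = lab (α x) := fun x => by
      rw [← hlab.part_iff, ← hsame.part]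
      change PartiteRamsey.Part _ (h (f (e x)))
      rw [hj, part_iff_of_embedding, ← part_iff_of_embedding iA, hlab.part_iff]
    have hemono : StrictMono e := fun x y hxy => by
      rw [← hφA, lt_iff_of_embedding, ← lt_iff_of_embedding j, ← hj, ← hj] at hxy
      rw [← hφB]
      exact (hsame.lt _ _).1 hxy
    have hedgee : ∀ x y, Edge (β (e x)) (β (e y)) ↔ Edge (α x) (α y) := fun x y => by
      rw [← hsame.edge]
      change Edge (h (f (e x))) (h (f (e y))) ↔ _
      rw [hj, hj, edge_iff_of_embedding, ← edge_iff_of_embedding iA]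
    -- The copy is spanned by its increasing enumeration, so its colour is that of the tuple `f ∘
    -- e`.
    have hsub : sub a (f ∘ e) = A₁ := by
      ext z
      rw [mem_closure_range]
      constructor
      · rintro ⟨x, rfl⟩
        change hC (f (e x)) ∈ A₁
        rw [he]
        exact Subtype.prop _
      · intro hz
        refine ⟨φA (ψ ⟨z, hz⟩), ?_⟩
        change hC (f (e _)) = _
        rw [he]
        simp
    have hA₁ : A₁ ∈ Copies (expandedLanguage n) S A := ⟨ψ⟩
    subst hsub
    rw [← hcol e hemono fun x y => Prod.ext (hlabe x) (by
      simp only [pattern, hlabe, hedgee]), dif_pos hA₁]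

end PartiteRamsey

theorem mainTheorem5 (n : ℕ) (M : Type*) [Countable M] [FirstOrder.Language.graph.Structure M]
    (hM : PartiteRamsey.IsGenericPartite M n)
    [(PartiteRamsey.partOrder n).Structure M]
    (hM' : PartiteRamsey.IsConvexPartExpansion n M) :
    PartiteRamsey.RamseyProperty ((PartiteRamsey.expandedLanguage n).age M) :=
  PartiteRamsey.IsGenericPartite.ramseyProperty_age hM hM'
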